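/- A multigraph is a pair $G=(\mathcal V,\mathcal E)$ with $\mathcal V$ finite and $\mathcal E\subset\mathcal V\times\mathcal V$ symmetric; self-loops $(v,v)\in\mathcal E$ are allowed. Write $u - v$ for $(u,v)\in\mathcal E$, and for $U\subset\mathcal V$ let $\mathcal E(U)=\{v:\exists u\in U,\ u-v\}$. An independent set is a non-empty $\mathcal I\subset\mathcal V$ such that $(i,j)\notin\mathcal E$ for all $i,j\in\mathcal I$ (including $i=j$). $G$ is a bipartite graph if it has no self-loop and $\mathcal V$ splits into two disjoint sets such that every edge joins one to the other. Let $\mathscr M(\mathcal V)$ be the set of probability measures on $\mathcal V$ with full support, and $$\mathrm{Ncond}(G)=\{\mu\in\mathscr M(\mathcal V):\ \mu(\mathcal I)<\mu(\mathcal E(\mathcal I))\ \text{for every independent set }\mathcal I\}.$$ Matching model. Let $\mu\in\mathscr M(\mathcal V)$. The state is the word $w$ over $\mathcal V$ listing the classes of the stored items in order of arrival. It ranges over the set $\mathbb W$ of words in which no two distinct neighbouring classes both occur and in which each class with a self-loop occurs at most once. Let $x(j)$ denote the number of stored items of class $j$. At each step an item of class $v$ arrives, with $v$ drawn from $\mu$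 independently of the past. If no stored item has a class $j$ with $v-j$, the letter $v$ is appended to $w$. Otherwise the arriving item is matched with the oldest stored item of a class $j$ chosen by the policy $\Phi$ among the classes with $v-j$ and $x(j)>0$; that stored item leaves, and the arriving item is not stored. In a Max-Weight policy with parameter $\beta\in\mathbb R$ and real rewards $(r_{i,j})_{(i,j)\in\mathcal E}$, the class $j$ is drawn uniformly at random among the maximizers of $\beta x(j)+r_{v,j}$ over the classes $j$ with $v-j$ and $x(j)>0$. Let $\mathrm{Stab}(G,\Phi)$ be the set of $\mu\in\mathscr M(\mathcal V)$ for which the resulting Markov chain on $\mathbb W$ is positive recurrent, i.e. every state has a finite expected return time. Theorem. Let $G$ be a connected multigraph that is not a bipartite graph. Then every Max-Weight policy $\Phi$ with $\beta>0$, for any rewards, is maximal: $$\mathrm{Stab}(G,\Phi)=\mathrm{Ncond}(G).$$ -/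

import Mathlib

open MeasureTheory ProbabilityTheory
open scoped ENNReal

noncomputable section

/-! ### Multigraphs -/

/-- A multigraph on the node set `V`: a symmetric set of ordered pairs of nodes.
Self-loops are allowed, parallel edges are not. -/
structure LoopGraph (V : Type*) where
  Adj : V → V → Prop
  symm : ∀ u v, Adj u v → Adj v u

namespace LoopGraph

variable {V : Type*}

/-- Any two nodes are joined by a path. -/
def Connected (G : LoopGraph V) : Prop :=
  ∀ u v, Relation.ReflTransGen G.Adj u v

/-- `G` is a bipartite graph: there is no self-loop, and the nodes can be split into `A` and its
complement so that every edge joins `A` to its complement. -/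
def IsBipartiteGraph (G : LoopGraph V) : Prop :=
  (∀ v, ¬ G.Adj v v) ∧ ∃ A : Set V, ∀ u v, G.Adj u v → (u ∈ A ↔ v ∉ A)

/-- The neighbourhood of a set of nodes. -/
def nbhd (G : LoopGraph V) (U : Set V) : Set V := {v | ∃ u ∈ U, G.Adj u v}

/-- Non-empty sets of nodes that contain no pair of neighbours, hence no node with a self-loop. -/
def IsIndep (G : LoopGraph V) (I : Set V) : Prop :=
  I.Nonempty ∧ ∀ i ∈ I, ∀ j ∈ I, ¬ G.Adj i j

/-- The probability measures `μ` of full support such that `μ(I) < μ(E(I))` for every independent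
set `I`. -/
def Ncond (G : LoopGraph V) : Set (PMF V) :=
  {μ | (∀ v, μ v ≠ 0) ∧
    ∀ I : Set V, G.IsIndep I → μ.toOuterMeasure I < μ.toOuterMeasure (G.nbhd I)}

end LoopGraph

/-! ### Positive recurrence of a Markov chain on a countable state space -/

section MarkovChain

variable {S : Type*} [MeasurableSpace S] [DiscreteMeasurableSpace S] [Countable S]

/-- The kernel of the chain with transition probabilities `P`: given the trajectory up to time
`n`, the next state has law `P` of the state at time `n`. -/
def chainKernel (P : S → PMF S) (n : ℕ) : Kernel (Finset.Iic n → S) S :=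
  Kernel.ofFunOfCountable fun h => (P (h ⟨n, Finset.mem_Iic.2 le_rfl⟩)).toMeasure

instance (P : S → PMF S) (n : ℕ) : IsMarkovKernel (chainKernel P n) :=
  ⟨fun _ => PMF.toMeasure.isProbabilityMeasure _⟩

/-- The law, on the space of trajectories, of the Markov chain with transition probabilities `P`
started at `x`. -/
def chainLaw (P : S → PMF S) (x : S) : Measure (ℕ → S) :=
  Kernel.traj (X := fun _ => S) (chainKernel P) 0 (fun _ => x)

/-- The first time `n ≥ 1` at which the trajectory is at `x`, equal to `∞` if there is none. -/
def returnTime (x : S) (ω : ℕ → S) : ℝ≥0∞ :=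
  ⨅ (n : ℕ) (_ : 1 ≤ n ∧ ω n = x), (n : ℝ≥0∞)

/-- Every state has a finite expected return time. -/
def PositiveRecurrent (P : S → PMF S) : Prop :=
  ∀ x, ∫⁻ ω, returnTime x ω ∂(chainLaw P x) < ∞

end MarkovChain

/-! ### The stochastic matching model -/

namespace LoopGraph

variable {V : Type*} [Fintype V] [DecidableEq V]

/-- The admissible queue details: words over `V` in which no two different neighbouring classes
occur, and in which each class with a self-loop occurs at most once. -/
def QueueDetail (G : LoopGraph V) : Type _ :=
  {w : List V // (∀ i j, i ≠ j → G.Adj i j → w.count i * w.count j = 0) ∧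
    ∀ i, G.Adj i i → w.count i ≤ 1}

namespace QueueDetail

instance (G : LoopGraph V) : MeasurableSpace G.QueueDetail := ⊤

instance (G : LoopGraph V) : DiscreteMeasurableSpace G.QueueDetail := ⟨fun _ => trivial⟩

instance (G : LoopGraph V) : Countable G.QueueDetail :=
  inferInstanceAs (Countable {_w : List V // _})

/-- The class detail of a queue detail: the number of stored items of each class. -/
def classDetail {G : LoopGraph V} (w : G.QueueDetail) : V → ℕ := fun i => w.1.count i

end QueueDetail

open Classical in
/-- The classes that are compatible with `v` and present in the class detail `x`. -/
def available (G : LoopGraph V) (x : V → ℕ) (v : V) : Finset V :=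
  Finset.univ.filter fun j => G.Adj v j ∧ 0 < x j

/-- A class-admissible matching policy: when the class detail is `x` and an item of class `v`
finds a compatible class in the buffer, the class of its match is drawn from a law on the
available classes that depends only on `x` and `v`. -/
structure ClassPolicy (G : LoopGraph V) where
  choice : ∀ (x : V → ℕ) (v : V), (G.available x v).Nonempty → PMF V
  choice_mem : ∀ x v h, ∀ j ∈ (choice x v h).support, j ∈ G.available x v

/-- The queue detail after an unmatched item of class `v` joins the end of the line. -/
def enqueue (G : LoopGraph V) (w : G.QueueDetail) (v : V)
    (h : ¬ (G.available w.classDetail v).Nonempty) : G.QueueDetail :=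
  ⟨w.1 ++ [v], by
    have h0 : ∀ j, G.Adj v j → w.1.count j = 0 := by
      intro j hj
      by_contra hc
      exact h ⟨j, by
        simp only [available, Finset.mem_filter, Finset.mem_univ, true_and]
        exact ⟨hj, Nat.pos_of_ne_zero hc⟩⟩
    refine ⟨fun i j hij ha => ?_, fun i hi => ?_⟩
    · have hw := w.2.1 i j hij ha
      by_cases hi : v = i
      · subst hi
        have := h0 j ha
        simp [List.count_append, this, hij]
      · by_cases hj : v = j
        · subst hj
          have := h0 i (G.symm _ _ ha)
          simp [List.count_append, this, hi]
        · simpa [List.count_append, List.count_singleton, hi, hj] using hw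
    · have hw := w.2.2 i hi
      by_cases hv : v = i
      · subst hv
        simp [List.count_append, h0 v hi]
      · simpa [List.count_append, List.count_singleton, hv] using hw⟩

/-- The queue detail after the oldest stored item of class `j` leaves. -/
def dequeue (G : LoopGraph V) (w : G.QueueDetail) (j : V) : G.QueueDetail :=
  ⟨w.1.erase j, by
    have hle : ∀ i, (w.1.erase j).count i ≤ w.1.count i :=
      fun i => (List.erase_sublist).count_le i
    refine ⟨fun i k hik ha => ?_, fun i hi => (hle i).trans (w.2.2 i hi)⟩
    have h1 := Nat.mul_le_mul (hle i) (hle k)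
    rw [w.2.1 i k hik ha] at h1
    exact Nat.le_zero.1 h1⟩

open Classical in
/-- The law of the queue detail reached from `w` when an item of class `v` arrives. -/
def arrival (G : LoopGraph V) (Φ : G.ClassPolicy) (w : G.QueueDetail) (v : V) :
    PMF G.QueueDetail :=
  if h : (G.available w.classDetail v).Nonempty then
    (Φ.choice w.classDetail v h).map (G.dequeue w)
  else PMF.pure (G.enqueue w v h)

/-- The transition probabilities of the buffer-content chain: the class of the arriving item is
drawn from `μ`, independently of the past. -/
def transition (G : LoopGraph V) (Φ : G.ClassPolicy) (μ : PMF V) (w : G.QueueDetail) :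
    PMF G.QueueDetail :=
  μ.bind (G.arrival Φ w)

/-- The stability region: the probability measures of full support for which the buffer-content
chain is positive recurrent. -/
def Stab (G : LoopGraph V) (Φ : G.ClassPolicy) : Set (PMF V) :=
  {μ | (∀ v, μ v ≠ 0) ∧ PositiveRecurrent (G.transition Φ μ)}

open Classical in
/-- The available classes `j` that maximize `β x(j) + r(v, j)`. -/
def maxWeightSet (G : LoopGraph V) (β : ℝ) (r : V → V → ℝ) (x : V → ℕ) (v : V) : Finset V :=
  (G.available x v).filter fun j =>
    ∀ k ∈ G.available x v, β * (x k : ℝ) + r v k ≤ β * (x j : ℝ) + r v j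

theorem maxWeightSet_nonempty (G : LoopGraph V) (β : ℝ) (r : V → V → ℝ) (x : V → ℕ) (v : V)
    (h : (G.available x v).Nonempty) : (G.maxWeightSet β r x v).Nonempty := by
  obtain ⟨j, hj, hmax⟩ :=
    Finset.exists_max_image (G.available x v) (fun k => β * (x k : ℝ) + r v k) h
  exact ⟨j, Finset.mem_filter.2 ⟨hj, hmax⟩⟩

/-- The Max-Weight policy with parameter `β` and reward `r i j` for the match of an arriving
`i`-item with a stored `j`-item (only the values on edges matter); ties are broken uniformly at
random. -/
def maxWeight (G : LoopGraph V) (β : ℝ) (r : V → V → ℝ) : G.ClassPolicy where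
  choice x v h := PMF.uniformOfFinset (G.maxWeightSet β r x v) (G.maxWeightSet_nonempty β r x v h)
  choice_mem x v h j hj := by
    rw [PMF.mem_support_uniformOfFinset_iff] at hj
    exact (Finset.mem_filter.1 hj).1

end LoopGraph

end

/-! Necessity holds for every policy. Suppose `μ(E(I)) ≤ μ(I)` for some independent `I`. The
truncated difference between the numbers of stored items in `I` and in `E(I)` is then a
submartingale (`excess_le_tsum`), vanishes at the empty word and grows by at most one per step.
Hence from a one-letter word with letter in `I`, the empty word is avoided for `n` steps with
probability at least `1/(n+1)` (`excess_le_mul_avoidProb`). The harmonic series diverges, and with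
it the expected return time to the empty word.

Sufficiency is Foster's criterion (`positiveRecurrent_of_drift`) for the Lyapunov function `∑
x(i)²`. Max-Weight picks a class whose queue is, up to a constant depending on the rewards and `β`,
the longest among the neighbours. So the drift is at most `2 (∑ μ(v) y(v) - ∑ μ(v) M(v)) + C`, where
`y` counts the items of classes without self-loop and `M(v)` is the maximum of `y` over the
neighbours of `v` (`sqSum_le_of_arrival_ne_zero`). The non-empty level sets `{y > t}` are
independent with neighbourhoods `{M > t}`; summing the `Ncond` inequalities over `t` makes the
bracket at most `-ε max y` (`sum_mul_add_le_sum_mul_nbhdMax`), so the drift is negative on long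
words. -/

/-! ### Return times, the chain killed at a state, and Foster's criterion. -/

section MarkovChain

variable {S : Type*}

/-- The expectation of `f` after one step of the chain with transition probabilities `P`, on the
event that this step does not lead to `x`. -/
noncomputable def killedStep (P : S → PMF S) (x : S) (f : S → ℝ≥0∞) (y : S) : ℝ≥0∞ :=
  ∑' z, P y z * ({x}ᶜ : Set S).indicator f z

/-- The probability that the chain started at `y` is not at `x` at any of the times
`1, …, n`. -/
noncomputable def avoidProb (P : S → PMF S) (x : S) (n : ℕ) : S → ℝ≥0∞ :=
  (killedStep P x)^[n] 1

theorem avoidProb_zero (P : S → PMF S) (x y : S) : avoidProb P x 0 y = 1 := rfl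

theorem avoidProb_succ (P : S → PMF S) (x : S) (n : ℕ) :
    avoidProb P x (n + 1) = killedStep P x (avoidProb P x n) :=
  Function.iterate_succ_apply' _ _ _

/-- The indicator of the trajectories that do not visit `x` at any of the times `1, …, n`. -/
noncomputable def avoidIndicator (x : S) (n : ℕ) (ω : ℕ → S) : ℝ≥0∞ :=
  {ω : ℕ → S | ∀ k, 1 ≤ k → k ≤ n → ω k ≠ x}.indicator 1 ω

/-- Moving the constraint at time `n + 1` onto `f` prepares for integrating out the last step by the
Markov property. -/
theorem avoidIndicator_succ (x : S) (n : ℕ) (f : S → ℝ≥0∞) (ω : ℕ → S) :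
    avoidIndicator x (n + 1) ω * f (ω (n + 1)) =
      avoidIndicator x n ω * ({x}ᶜ : Set S).indicator f (ω (n + 1)) := by
  classical
  simp only [avoidIndicator, Set.indicator_apply, Set.mem_ofPred_eq, Set.mem_compl_iff,
    Set.mem_singleton_iff, Pi.one_apply]
  by_cases hx : ω (n + 1) = x
  · rw [if_neg (fun h => h (n + 1) (by omega) le_rfl hx), if_neg (not_not.2 hx)]
    simp
  · rw [if_pos hx]
    congr 2
    refine propext ⟨fun h k h1 h2 => h k h1 (by omega), fun h k h1 h2 => ?_⟩
    rcases Nat.lt_or_ge n k with h3 | h3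
    · rwa [show k = n + 1 by omega]
    · exact h k h1 h3

/-- The tail-sum formula: a return time `T`, finite or not, is the sum over `n` of the indicators of
`T > n`. -/
theorem returnTime_eq_tsum (x : S) (ω : ℕ → S) :
    returnTime x ω = ∑' n, avoidIndicator x n ω := by
  classical
  simp only [avoidIndicator, Set.indicator_apply, Set.mem_ofPred_eq, Pi.one_apply, returnTime]
  by_cases h : ∃ n, 1 ≤ n ∧ ω n = x
  · have hs := Nat.find_spec h
    have hm : ∀ n, (∀ k, 1 ≤ k → k ≤ n → ω k ≠ x) ↔ n ∈ Finset.range (Nat.find h) := by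
      intro n
      rw [Finset.mem_range]
      refine ⟨fun hn => not_le.1 fun hle => hn _ hs.1 hle hs.2, fun hn k h1 h2 hk => ?_⟩
      exact Nat.find_min h (lt_of_le_of_lt h2 hn) ⟨h1, hk⟩
    simp only [hm]
    rw [tsum_eq_sum (s := Finset.range (Nat.find h)) (fun n hn => if_neg hn)]
    rw [Finset.sum_congr rfl (fun n hn => if_pos hn)]
    simp only [Finset.sum_const, Finset.card_range, nsmul_eq_mul, mul_one]
    refine le_antisymm (iInf₂_le (f := fun n (_ : 1 ≤ n ∧ ω n = x) => (n : ℝ≥0∞)) _ hs)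
      (le_iInf₂ fun n hn => ?_)
    exact_mod_cast Nat.find_min' h hn
  · have hn : ∀ n, ¬ (1 ≤ n ∧ ω n = x) := fun n hn => h ⟨n, hn⟩
    have hm : ∀ n, (∀ k, 1 ≤ k → k ≤ n → ω k ≠ x) := fun n k h1 _ hk => hn k ⟨h1, hk⟩
    rw [tsum_congr fun n => if_pos (hm n)]
    simp [hn]

section Killed

variable (P : S → PMF S) (x : S)

/-- The comparison is asked only at possible successors other than `x`, so that bounds on the
increments of the chain can be used. -/
theorem killedStep_le_killedStep {f g : S → ℝ≥0∞} {y : S}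
    (h : ∀ z, P y z ≠ 0 → z ≠ x → f z ≤ g z) :
    killedStep P x f y ≤ killedStep P x g y := by
  refine ENNReal.tsum_le_tsum fun z => ?_
  by_cases hz : P y z = 0
  · simp [hz]
  · exact mul_le_mul_right (Set.indicator_le_indicator' (h z hz)) _

theorem killedStep_mono {f g : S → ℝ≥0∞} (h : ∀ z, f z ≤ g z) (y : S) :
    killedStep P x f y ≤ killedStep P x g y :=
  killedStep_le_killedStep P x fun z _ _ => h z

theorem killedStep_le (f : S → ℝ≥0∞) (y : S) : killedStep P x f y ≤ ∑' z, P y z * f z :=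
  ENNReal.tsum_le_tsum fun _ => mul_le_mul_right (Set.indicator_le_self _ _ _) _

theorem killedStep_eq (f : S → ℝ≥0∞) (hf : f x = 0) (y : S) :
    killedStep P x f y = ∑' z, P y z * f z := by
  refine tsum_congr fun z => ?_
  by_cases hz : z = x
  · simp [hz, hf]
  · rw [Set.indicator_of_mem (by simpa using hz)]

theorem killedStep_add (f g : S → ℝ≥0∞) (y : S) :
    killedStep P x (fun z => f z + g z) y = killedStep P x f y + killedStep P x g y := by
  simp only [killedStep]
  rw [← ENNReal.tsum_add]
  refine tsum_congr fun z => ?_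
  rw [← mul_add]
  congr 1
  exact congrFun (Set.indicator_add _ f g) z

theorem killedStep_const_mul (c : ℝ≥0∞) (f : S → ℝ≥0∞) (y : S) :
    killedStep P x (fun z => c * f z) y = c * killedStep P x f y := by
  simp only [killedStep]
  rw [← ENNReal.tsum_mul_left]
  refine tsum_congr fun z => ?_
  by_cases hz : z = x <;> simp [hz, mul_left_comm]

theorem le_killedStep (f : S → ℝ≥0∞) (y : S) {z : S} (hz : z ≠ x) :
    P y z * f z ≤ killedStep P x f y := by
  refine le_trans ?_ (ENNReal.le_tsum z)
  rw [Set.indicator_of_mem (by simpa using hz)]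

theorem avoidProb_le_one (n : ℕ) (y : S) : avoidProb P x n y ≤ 1 := by
  induction n generalizing y with
  | zero => exact le_rfl
  | succ n ih =>
    rw [avoidProb_succ]
    refine (killedStep_mono P x (g := 1) ih y).trans
      ((killedStep_le P x _ y).trans ?_)
    simp [(P y).tsum_coe]

theorem killedStep_sum_avoidProb (N : ℕ) (y : S) :
    killedStep P x (fun z => ∑ n ∈ Finset.range N, avoidProb P x n z) y =
      ∑ n ∈ Finset.range N, avoidProb P x (n + 1) y := by
  induction N with
  | zero => simp [killedStep]
  | succ k ih =>
    simp only [Finset.sum_range_succ]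
    rw [killedStep_add P x (fun z => ∑ n ∈ Finset.range k, avoidProb P x n z) (avoidProb P x k),
      ih, avoidProb_succ P x k]

theorem avoidProb_antitone (y : S) : Antitone fun n => avoidProb P x n y := by
  refine antitone_nat_of_succ_le fun n => ?_
  induction n generalizing y with
  | zero => exact avoidProb_le_one P x 1 y
  | succ n ih =>
    have h := killedStep_mono P x ih y
    rwa [← avoidProb_succ, ← avoidProb_succ] at h

/-- A state from which `x` can be reached avoids `x` up to some time with probability less than
one. -/
theorem exists_avoidProb_lt_one {y : S}
    (h : Relation.TransGen (fun a b => P a b ≠ 0) y x) : ∃ n, avoidProb P x n y < 1 := by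
  -- Mass lost at one possible successor makes the whole average less than one. At the end of the
  -- path the loss comes from killing at `x`; it is then carried back along the path.
  have key : ∀ (a b : S) (f : S → ℝ≥0∞), P a b ≠ 0 → (∀ z, f z ≤ 1) →
      ({x}ᶜ : Set S).indicator f b < 1 → killedStep P x f a < 1 := by
    intro a b f hab hf hb
    have hle : ∀ z, P a z * ({x}ᶜ : Set S).indicator f z ≤ P a z := fun z =>
      mul_le_of_le_one_right' ((Set.indicator_le_self _ _ _).trans (hf z))
    rw [← (P a).tsum_coe]
    refine ENNReal.tsum_lt_tsum (i := b) ?_ hle ?_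
    · exact ne_top_of_le_ne_top (by simp [(P a).tsum_coe]) (ENNReal.tsum_le_tsum hle)
    · calc _ < P a b * 1 := ENNReal.mul_lt_mul_right hab ((P a).apply_ne_top b) hb
        _ = P a b := mul_one _
  induction h using Relation.TransGen.head_induction_on with
  | single h =>
    refine ⟨1, ?_⟩
    rw [avoidProb_succ]
    exact key _ x _ h (avoidProb_le_one P x 0) (by simp)
  | head h _ ih =>
    obtain ⟨n, hn⟩ := ih
    refine ⟨n + 1, ?_⟩
    rw [avoidProb_succ]
    exact key _ _ _ h (avoidProb_le_one P x n) ((Set.indicator_le_self _ _ _).trans_lt hn)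

end Killed

variable [MeasurableSpace S] [DiscreteMeasurableSpace S] [Countable S]

instance (P : S → PMF S) (x : S) : IsProbabilityMeasure (chainLaw P x) := by
  unfold chainLaw; infer_instance

theorem lintegral_toMeasure_eq_tsum (p : PMF S) (f : S → ℝ≥0∞) :
    ∫⁻ z, f z ∂p.toMeasure = ∑' z, p z * f z := by
  rw [lintegral_countable']
  exact tsum_congr fun z => by
    rw [PMF.toMeasure_apply_singleton _ _ (measurableSet_singleton z), mul_comm]

/-- The Markov property: the joint law of the past up to `n` and the next state is a
composition-product with the one-step kernel. -/
theorem lintegral_chainLaw_succ (P : S → PMF S) (x : S) (n : ℕ)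
    (g : (Finset.Iic n → S) → ℝ≥0∞) (f : S → ℝ≥0∞) :
    ∫⁻ ω, g (Preorder.frestrictLe n ω) * f (ω (n + 1)) ∂chainLaw P x =
      ∫⁻ ω, g (Preorder.frestrictLe n ω) * ∑' z, P (ω n) z * f z ∂chainLaw P x := by
  have h := Kernel.partialTraj_compProd_eq_map_traj (κ := chainKernel P) (Nat.zero_le n)
    (x₀ := fun _ => x) (X := fun _ => S)
  have hF : Measurable fun p : (Finset.Iic n → S) × S => g p.1 * f p.2 := measurable_of_countable _
  have h1 : ∫⁻ p, g p.1 * f p.2 ∂((Kernel.traj (X := fun _ => S) (chainKernel P) 0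
      (fun _ => x)).map (fun x ↦ (Preorder.frestrictLe n x, x (n + 1)))) =
      ∫⁻ ω, g (Preorder.frestrictLe n ω) * f (ω (n + 1)) ∂chainLaw P x := by
    rw [lintegral_map hF (by fun_prop)]
    rfl
  rw [← h1, ← h, Measure.lintegral_compProd hF, ← Kernel.traj_map_frestrictLe_apply,
    lintegral_map (measurable_of_countable _) (by fun_prop)]
  refine lintegral_congr fun ω => ?_
  dsimp only
  rw [lintegral_const_mul _ (measurable_of_countable _)]
  congr 1
  exact lintegral_toMeasure_eq_tsum _ _

theorem lintegral_avoidIndicator_mul (P : S → PMF S) (x : S) (n : ℕ) (f : S → ℝ≥0∞) :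
    ∫⁻ ω, avoidIndicator x n ω * f (ω n) ∂chainLaw P x = (killedStep P x)^[n] f x := by
  induction n generalizing f with
  | zero =>
    have h : (chainLaw P x).map (Preorder.frestrictLe 0) = Measure.dirac (fun _ => x) := by
      rw [chainLaw, Kernel.traj_map_frestrictLe_apply, Kernel.partialTraj_self, Kernel.id_apply]
    have h2 : ∫⁻ ω, f (ω 0) ∂chainLaw P x = f x := by
      have h3 : ∫⁻ p : Finset.Iic 0 → S, f (p ⟨0, by simp⟩)
          ∂((chainLaw P x).map (Preorder.frestrictLe 0)) = ∫⁻ ω, f (ω 0) ∂chainLaw P x := by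
        rw [lintegral_map (measurable_of_countable _) (by fun_prop)]
        rfl
      rw [← h3, h, lintegral_dirac]
    rw [Function.iterate_zero, id, ← h2]
    refine lintegral_congr fun ω => ?_
    have : avoidIndicator x 0 ω = 1 :=
      Set.indicator_of_mem (fun k h1 h2 => absurd h1 (by omega)) _
    rw [this, one_mul]
  | succ n ih =>
    simp only [avoidIndicator_succ]
    rw [Function.iterate_succ_apply, ← ih]
    have := lintegral_chainLaw_succ P x n
      (fun h => {h : Finset.Iic n → S | ∀ k, 1 ≤ k.1 → h k ≠ x}.indicator 1 h)
      (({x}ᶜ : Set S).indicator f)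
    have he : ∀ ω : ℕ → S, {h : Finset.Iic n → S | ∀ k, 1 ≤ k.1 → h k ≠ x}.indicator
        (1 : (Finset.Iic n → S) → ℝ≥0∞) (Preorder.frestrictLe n ω) = avoidIndicator x n ω := by
      classical
      intro ω
      simp only [avoidIndicator, Set.indicator_apply, Set.mem_ofPred_eq, Pi.one_apply]
      congr 1
      refine propext ⟨fun h k h1 h2 => h ⟨k, Finset.mem_Iic.2 h2⟩ h1, fun h k h1 => ?_⟩
      exact h k.1 h1 (Finset.mem_Iic.1 k.2)
    simp only [he] at this
    exact this

theorem measurable_avoidIndicator (x : S) (n : ℕ) : Measurable (avoidIndicator x n) := by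
  refine measurable_one.indicator ?_
  simp only [Set.ofPred_forall]
  refine MeasurableSet.iInter fun k => MeasurableSet.iInter fun _ => MeasurableSet.iInter fun _ => ?_
  exact measurableSet_preimage (f := fun ω : ℕ → S => ω k) (measurable_pi_apply k)
    (measurableSet_singleton x).compl

/-- The expected return time is the sum of the probabilities of no return up to time `n`. -/
theorem lintegral_returnTime (P : S → PMF S) (x : S) :
    ∫⁻ ω, returnTime x ω ∂chainLaw P x = ∑' n, avoidProb P x n x := by
  simp only [returnTime_eq_tsum]
  rw [lintegral_tsum fun n => (measurable_avoidIndicator x n).aemeasurable]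
  refine tsum_congr fun n => ?_
  rw [avoidProb, ← lintegral_avoidIndicator_mul]
  simp

/-- Foster's criterion: a chain in which every state can be reached from every state, with a
function whose mean decreases by `ε` in one step outside a finite set, is positive recurrent. -/
theorem positiveRecurrent_of_drift (P : S → PMF S)
    (hirr : ∀ y x, Relation.TransGen (fun a b => P a b ≠ 0) y x)
    (L : S → ℝ≥0∞) (hL : ∀ y, L y ≠ ∞) (F : Set S) (hF : F.Finite) (ε B : ℝ≥0∞) (hε : ε ≠ 0)
    (hB : B ≠ ∞)
    (hdrift : ∀ y, ∑' z, P y z * L z + ε ≤ L y + F.indicator (fun _ => B) y) :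
    PositiveRecurrent P := by
  intro x
  rw [lintegral_returnTime]
  -- Since `F` is finite, one horizon `M` and one `δ > 0` serve all its points: from each, `x` is
  -- hit within `M` steps with probability at least `δ`.
  obtain ⟨M, δ, hδ0, hδ⟩ : ∃ (M : ℕ) (δ : ℝ≥0∞), δ ≠ 0 ∧
      ∀ y, avoidProb P x M y + F.indicator (fun _ => δ) y ≤ 1 := by
    choose m hm using fun y => exists_avoidProb_lt_one P x (hirr y x)
    obtain ⟨M, hM⟩ : ∃ M, ∀ y ∈ F, m y ≤ M := by
      obtain ⟨M, hM⟩ := (hF.image m).bddAbove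
      exact ⟨M, fun y hy => hM ⟨y, hy, rfl⟩⟩
    have hlt : ∀ y ∈ F, avoidProb P x M y < 1 := fun y hy =>
      lt_of_le_of_lt (avoidProb_antitone P x y (hM y hy)) (hm y)
    refine ⟨M, 1 - hF.toFinset.sup (avoidProb P x M), ?_, fun y => ?_⟩
    · rw [Ne, tsub_eq_zero_iff_le, not_le, Finset.sup_lt_iff (by simp)]
      exact fun y hy => hlt y (hF.mem_toFinset.1 hy)
    · by_cases hy : y ∈ F
      · rw [Set.indicator_of_mem hy]
        refine le_trans (add_le_add_right (tsub_le_tsub_left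
          (Finset.le_sup (f := avoidProb P x M) (hF.mem_toFinset.2 hy)) 1) _) ?_
        rw [add_tsub_cancel_of_le (avoidProb_le_one P x M y)]
      · rw [Set.indicator_of_notMem hy, add_zero]
        exact avoidProb_le_one P x M y
  -- The expected return time truncated at `M`. Telescoping shows that the killed step never
  -- increases it and decreases it by at least `δ` on `F`.
  set U : S → ℝ≥0∞ := fun y => ∑ n ∈ Finset.range M, avoidProb P x n y with hU
  have hUtop : ∀ y, U y ≠ ∞ := fun y => (ENNReal.sum_lt_top.2 fun n _ =>
    lt_of_le_of_lt (avoidProb_le_one P x n y) ENNReal.one_lt_top).ne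
  have hUstep : ∀ y, killedStep P x U y + F.indicator (fun _ => δ) y ≤ U y := by
    intro y
    have h1 : killedStep P x U y = ∑ n ∈ Finset.range M, avoidProb P x (n + 1) y :=
      killedStep_sum_avoidProb P x M y
    have h2 : killedStep P x U y + 1 = U y + avoidProb P x M y := by
      rw [h1, hU, ← Finset.sum_range_succ, Finset.sum_range_succ', avoidProb_zero]
    have h3 : avoidProb P x M y ≠ ∞ :=
      ne_top_of_le_ne_top ENNReal.one_ne_top (avoidProb_le_one P x M y)
    refine (ENNReal.add_le_add_iff_right h3).1 ?_
    rw [← h2, add_assoc, add_comm _ (avoidProb P x M y)]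
    exact add_le_add_right (hδ y) _
  have hδtop : ∀ y ∈ F, δ ≠ ∞ := fun y hy => by
    have := le_trans le_add_self (hδ y)
    rw [Set.indicator_of_mem hy] at this
    exact ne_top_of_le_ne_top ENNReal.one_ne_top this
  -- With this weight the decrease `c * δ` of `c * U` on `F` cancels the excess `B` there, so `W`
  -- decreases by `ε` everywhere.
  set c : ℝ≥0∞ := B / δ with hc
  have hctop : c ≠ ∞ := ENNReal.div_ne_top hB hδ0
  set W : S → ℝ≥0∞ := fun y => L y + c * U y with hW
  have hWtop : ∀ y, W y ≠ ∞ := fun y =>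
    ENNReal.add_ne_top.2 ⟨hL y, ENNReal.mul_ne_top hctop (hUtop y)⟩
  have hWstep : ∀ y, killedStep P x W y + ε ≤ W y := by
    intro y
    have h1 : killedStep P x W y = killedStep P x L y + c * killedStep P x U y := by
      rw [hW, killedStep_add, killedStep_const_mul]
    have h2 : F.indicator (fun _ => B) y = c * F.indicator (fun _ => δ) y := by
      by_cases hy : y ∈ F
      · rw [Set.indicator_of_mem hy, Set.indicator_of_mem hy, hc,
          ENNReal.div_mul_cancel hδ0 (hδtop y hy)]
      · simp [hy]
    have h3 : F.indicator (fun _ => B) y ≠ ∞ :=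
      ne_top_of_le_ne_top hB (Set.indicator_le_self' (fun _ _ => zero_le) y)
    refine (ENNReal.add_le_add_iff_right h3).1 ?_
    calc killedStep P x W y + ε + F.indicator (fun _ => B) y
        = (killedStep P x L y + ε) + c * (killedStep P x U y + F.indicator (fun _ => δ) y) := by
          rw [h1, mul_add, ← h2]; ring
      _ ≤ (L y + F.indicator (fun _ => B) y) + c * U y :=
          add_le_add ((add_le_add_left (killedStep_le P x L y) ε).trans (hdrift y))
            (mul_le_mul_right (hUstep y) _)
      _ = W y + F.indicator (fun _ => B) y := by rw [hW]; ring
  -- Each step before the return costs `ε` out of the initial budget `W y`.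
  have hsum : ∀ N y, ε * ∑ n ∈ Finset.range N, avoidProb P x n y ≤ W y := by
    intro N
    induction N with
    | zero => simp
    | succ N ih =>
      intro y
      have h1 : killedStep P x (fun y => ε * ∑ n ∈ Finset.range N, avoidProb P x n y) y =
          ε * ∑ n ∈ Finset.range N, avoidProb P x (n + 1) y := by
        rw [killedStep_const_mul, killedStep_sum_avoidProb]
      rw [Finset.sum_range_succ', avoidProb_zero, mul_add, mul_one, ← h1]
      exact (add_le_add_left (killedStep_mono P x ih y) ε).trans (hWstep y)
  have hlim : ε * ∑' n, avoidProb P x n x ≤ W x := by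
    rw [ENNReal.tsum_eq_iSup_nat, ENNReal.mul_iSup]
    exact iSup_le fun N => hsum N x
  refine lt_top_iff_ne_top.2 fun htop => hWtop x ?_
  rw [htop, ENNReal.mul_top hε] at hlim
  exact top_le_iff.1 hlim

end MarkovChain

/-! ### Expectations under discrete laws. -/

namespace PMF

variable {α β : Type*}

theorem tsum_bind_mul (p : PMF α) (q : α → PMF β) (f : β → ℝ≥0∞) :
    ∑' z, p.bind q z * f z = ∑' a, p a * ∑' z, q a z * f z := by
  simp only [PMF.bind_apply, ← ENNReal.tsum_mul_right, ← ENNReal.tsum_mul_left]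
  rw [ENNReal.tsum_comm]
  simp only [mul_assoc]

theorem tsum_mul_le (p : PMF α) (f : α → ℝ≥0∞) (c : ℝ≥0∞) (h : ∀ z, p z ≠ 0 → f z ≤ c) :
    ∑' z, p z * f z ≤ c := by
  calc ∑' z, p z * f z ≤ ∑' z, p z * c := by
        refine ENNReal.tsum_le_tsum fun z => ?_
        by_cases hz : p z = 0
        · simp [hz]
        · exact mul_le_mul_right (h z hz) _
    _ = c := by rw [ENNReal.tsum_mul_right, p.tsum_coe, one_mul]

theorem le_tsum_mul (p : PMF α) (f : α → ℝ≥0∞) (c : ℝ≥0∞) (h : ∀ z, p z ≠ 0 → c ≤ f z) :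
    c ≤ ∑' z, p z * f z := by
  calc c = ∑' z, p z * c := by rw [ENNReal.tsum_mul_right, p.tsum_coe, one_mul]
    _ ≤ ∑' z, p z * f z := by
        refine ENNReal.tsum_le_tsum fun z => ?_
        by_cases hz : p z = 0
        · simp [hz]
        · exact mul_le_mul_right (h z hz) _

theorem bind_apply_ne_zero (p : PMF α) (q : α → PMF β) (b : β) :
    p.bind q b ≠ 0 ↔ ∃ a, p a ≠ 0 ∧ q a b ≠ 0 := by
  simp only [← PMF.mem_support_iff, PMF.mem_support_bind_iff]

end PMF

/-! ### One-step transitions of the matching chain. -/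

namespace LoopGraph

variable {V : Type*} [Fintype V] [DecidableEq V] {G : LoopGraph V}

omit [DecidableEq V] in
theorem mem_available {x : V → ℕ} {v j : V} : j ∈ G.available x v ↔ G.Adj v j ∧ 0 < x j := by
  simp [available]

theorem arrival_of_nonempty (Φ : G.ClassPolicy) (w : G.QueueDetail) (v : V)
    (h : (G.available w.classDetail v).Nonempty) :
    G.arrival Φ w v = (Φ.choice w.classDetail v h).map (G.dequeue w) := by
  rw [arrival, dif_pos h]

theorem arrival_of_not_nonempty (Φ : G.ClassPolicy) (w : G.QueueDetail) (v : V)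
    (h : ¬ (G.available w.classDetail v).Nonempty) :
    G.arrival Φ w v = PMF.pure (G.enqueue w v h) := by
  rw [arrival, dif_neg h]

theorem arrival_ne_zero {Φ : G.ClassPolicy} {w w' : G.QueueDetail} {v : V}
    (h : G.arrival Φ w v w' ≠ 0) :
    (∃ h : ¬ (G.available w.classDetail v).Nonempty, w' = G.enqueue w v h) ∨
    ∃ (h : (G.available w.classDetail v).Nonempty) (j : V),
      Φ.choice w.classDetail v h j ≠ 0 ∧ w' = G.dequeue w j := by
  by_cases ha : (G.available w.classDetail v).Nonempty
  · right
    rw [arrival_of_nonempty Φ w v ha, ← PMF.mem_support_iff, PMF.mem_support_map_iff] at h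
    obtain ⟨j, hj, rfl⟩ := h
    exact ⟨ha, j, (PMF.mem_support_iff _ _).1 hj, rfl⟩
  · left
    rw [arrival_of_not_nonempty Φ w v ha, ← PMF.mem_support_iff, PMF.mem_support_pure_iff] at h
    exact ⟨ha, h⟩

theorem transition_ne_zero {Φ : G.ClassPolicy} {μ : PMF V} {w w' : G.QueueDetail} :
    G.transition Φ μ w w' ≠ 0 ↔ ∃ v, μ v ≠ 0 ∧ G.arrival Φ w v w' ≠ 0 :=
  PMF.bind_apply_ne_zero _ _ _

theorem perm_cons_erase_of_choice {Φ : G.ClassPolicy} {w : G.QueueDetail} {v j : V}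
    {h : (G.available w.classDetail v).Nonempty} (hj : Φ.choice w.classDetail v h j ≠ 0) :
    G.Adj v j ∧ w.1.Perm (j :: w.1.erase j) := by
  have := mem_available.1 (Φ.choice_mem _ _ h j ((PMF.mem_support_iff _ _).2 hj))
  exact ⟨this.1, List.perm_cons_erase (List.count_pos_iff.1 this.2)⟩

theorem length_le_of_transition_ne_zero {Φ : G.ClassPolicy} {μ : PMF V} {w w' : G.QueueDetail}
    (h : G.transition Φ μ w w' ≠ 0) : w'.1.length ≤ w.1.length + 1 := by
  obtain ⟨v, -, hv⟩ := transition_ne_zero.1 h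
  rcases arrival_ne_zero hv with ⟨ha, rfl⟩ | ⟨ha, j, -, rfl⟩
  · simp [enqueue]
  · exact (List.erase_sublist.length_le).trans (Nat.le_succ _)

namespace QueueDetail

/-- The empty queue detail. -/
def empty (G : LoopGraph V) : G.QueueDetail := ⟨[], by simp, by simp⟩

end QueueDetail

/-! ### Irreducibility, via the empty word. -/

section Irreducible

variable (Φ : G.ClassPolicy) (μ : PMF V)

/-- An arriving neighbour of a stored class forces a match; whichever class the policy picks, the
word loses one letter. -/
theorem reflTransGen_empty (hμ : ∀ v, μ v ≠ 0) (hnb : ∀ v, ∃ u, G.Adj v u) (w : G.QueueDetail) :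
    Relation.ReflTransGen (fun a b => G.transition Φ μ a b ≠ 0) w (QueueDetail.empty G) := by
  induction hn : w.1.length generalizing w with
  | zero =>
    have : w = QueueDetail.empty G := Subtype.ext (List.length_eq_zero_iff.1 hn)
    rw [this]
  | succ n ih =>
    obtain ⟨i, hi⟩ : ∃ i, i ∈ w.1 := List.exists_mem_of_length_pos (by omega)
    obtain ⟨v, hv⟩ := hnb i
    have ha : (G.available w.classDetail v).Nonempty :=
      ⟨i, mem_available.2 ⟨G.symm _ _ hv, List.count_pos_iff.2 hi⟩⟩
    obtain ⟨j, hj⟩ := (Φ.choice w.classDetail v ha).support_nonempty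
    have hp := perm_cons_erase_of_choice ((PMF.mem_support_iff _ _).1 hj)
    refine Relation.ReflTransGen.head (b := G.dequeue w j)
      (transition_ne_zero.2 ⟨v, hμ v, ?_⟩) (ih _ ?_)
    · rw [arrival_of_nonempty Φ w v ha, ← PMF.mem_support_iff, PMF.mem_support_map_iff]
      exact ⟨j, hj, rfl⟩
    · have := hp.2.length_eq
      rw [List.length_cons] at this
      change (w.1.erase j).length = n
      omega

/-- The letters of the word can arrive in order: prefixes are admissible, and admissibility of the
next prefix rules out any match, so the policy is never consulted. -/
theorem reflTransGen_of_empty (hμ : ∀ v, μ v ≠ 0) (w : G.QueueDetail) :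
    Relation.ReflTransGen (fun a b => G.transition Φ μ a b ≠ 0) (QueueDetail.empty G) w := by
  obtain ⟨l, hl⟩ := w
  induction l using List.reverseRecOn with
  | nil => exact Relation.ReflTransGen.refl
  | append_singleton l v ih =>
    have hle : ∀ i, l.count i ≤ (l ++ [v]).count i := fun i =>
      (List.sublist_append_left l [v]).count_le i
    have hl' : (∀ i j, i ≠ j → G.Adj i j → l.count i * l.count j = 0) ∧
        ∀ i, G.Adj i i → l.count i ≤ 1 := by
      refine ⟨fun i j hij ha => ?_, fun i hi => (hle i).trans (hl.2 i hi)⟩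
      exact Nat.le_zero.1 ((Nat.mul_le_mul (hle i) (hle j)).trans (hl.1 i j hij ha).le)
    have hna : ¬ (G.available (QueueDetail.classDetail (⟨l, hl'⟩ : G.QueueDetail)) v).Nonempty := by
      rintro ⟨j, hj⟩
      obtain ⟨hvj, hpos⟩ := mem_available.1 hj
      change 0 < l.count j at hpos
      by_cases h : v = j
      · subst h
        have := hl.2 v hvj
        rw [List.count_append, List.count_singleton_self] at this
        omega
      · have := hl.1 v j h hvj
        rcases Nat.mul_eq_zero.1 this with h0 | h0
        · rw [List.count_append, List.count_singleton_self] at h0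
          omega
        · have := hle j
          omega
    refine Relation.ReflTransGen.tail (ih hl') (transition_ne_zero.2 ⟨v, hμ v, ?_⟩)
    rw [arrival_of_not_nonempty Φ _ v hna]
    exact (PMF.mem_support_iff _ _).1 ((PMF.mem_support_pure_iff _ _).2 rfl)

theorem transGen_transition (hμ : ∀ v, μ v ≠ 0) (hnb : ∀ v, ∃ u, G.Adj v u)
    (w w' : G.QueueDetail) :
    Relation.TransGen (fun a b => G.transition Φ μ a b ≠ 0) w w' := by
  -- An arbitrary first step makes the path non-trivial even when `w = w'`.
  obtain ⟨z, hz⟩ := (G.transition Φ μ w).support_nonempty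
  exact Relation.TransGen.head' ((PMF.mem_support_iff _ _).1 hz)
    ((reflTransGen_empty Φ μ hμ hnb z).trans (reflTransGen_of_empty Φ μ hμ w'))

end Irreducible

/-! ### Necessity of `Ncond`, for every policy. -/

section Necessity

open Classical in
/-- The number of stored items with class in `I` minus the number of those with class in the
neighbourhood of `I`, or `0` if this is negative. -/
noncomputable def excess (I : Set V) (w : G.QueueDetail) : ℕ :=
  w.1.countP (· ∈ I) - w.1.countP (· ∈ G.nbhd I)

omit [Fintype V] in
theorem excess_le_length (I : Set V) (w : G.QueueDetail) : excess I w ≤ w.1.length :=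
  (Nat.sub_le _ _).trans List.countP_le_length

/-- An arrival in `I` either joins the queue or removes an item of `E(I)`, and an item of `I` leaves
only through an arrival in `E(I)`. Positivity is needed because the subtraction is truncated: an
arrival in `I` need not raise an excess equal to `0`. -/
theorem excess_add_le {I : Set V} (hI : G.IsIndep I) {Φ : G.ClassPolicy} {w w' : G.QueueDetail}
    {v : V} (h : G.arrival Φ w v w' ≠ 0) (hpos : 0 < excess I w) :
    (excess I w : ℝ≥0∞) + I.indicator 1 v ≤ excess I w' + (G.nbhd I).indicator 1 v := by
  classical
  have hdisj : v ∈ I → v ∉ G.nbhd I := fun hv ⟨u, hu, huv⟩ => hI.2 u hu v hv huv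
  suffices hs : excess I w + (if v ∈ I then 1 else 0) ≤
      excess I w' + (if v ∈ G.nbhd I then 1 else 0) by
    simp only [Set.indicator_apply, Pi.one_apply]
    exact_mod_cast hs
  unfold excess at hpos ⊢
  rcases arrival_ne_zero h with ⟨ha, rfl⟩ | ⟨ha, j, hj, rfl⟩
  · simp only [enqueue, List.countP_append, List.countP_singleton, decide_eq_true_eq]
    by_cases hv : v ∈ I
    · simp only [hv, hdisj hv, if_true, if_false]
      omega
    · simp only [hv, if_false]
      split_ifs <;> omega
  · obtain ⟨hvj, hp⟩ := perm_cons_erase_of_choice hj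
    have h1 : ∀ s : Set V, w.1.countP (· ∈ s) =
        (w.1.erase j).countP (· ∈ s) + if j ∈ s then 1 else 0 := fun s => by
      rw [hp.countP_eq, List.countP_cons]
      simp
    have hvI : v ∈ I → j ∈ G.nbhd I := fun hv => ⟨v, hv, hvj⟩
    have hjI : j ∈ I → v ∈ G.nbhd I := fun hj => ⟨j, hj, G.symm _ _ hvj⟩
    have hvjI : v ∈ I → j ∉ I := fun hv hj => hI.2 v hv j hj hvj
    simp only [h1] at hpos ⊢
    simp only [dequeue]
    by_cases hv : v ∈ I
    · have := hvI hv
      have := hvjI hv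
      simp_all
      omega
    · by_cases hj : j ∈ I
      · have := hjI hj
        simp_all
        split_ifs <;> omega
      · simp_all
        split_ifs at * <;> omega

theorem excess_le_tsum {I : Set V} (hI : G.IsIndep I) (Φ : G.ClassPolicy) (μ : PMF V)
    (hle : μ.toOuterMeasure (G.nbhd I) ≤ μ.toOuterMeasure I) (w : G.QueueDetail) :
    (excess I w : ℝ≥0∞) ≤ ∑' z, G.transition Φ μ w z * (excess I z : ℝ≥0∞) := by
  rcases Nat.eq_zero_or_pos (excess I w) with h0 | hpos
  · simp [h0]
  have hsum : ∀ s : Set V, ∑' v, μ v * s.indicator 1 v = μ.toOuterMeasure s := fun s => by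
    rw [PMF.toOuterMeasure_apply]
    refine tsum_congr fun v => ?_
    by_cases hv : v ∈ s <;> simp [hv]
  have hfin : μ.toOuterMeasure (G.nbhd I) ≠ ∞ := by
    refine ne_top_of_le_ne_top ENNReal.one_ne_top ?_
    rw [← hsum]
    refine PMF.tsum_mul_le _ _ _ fun v _ => Set.indicator_le_self _ _ _
  refine (ENNReal.add_le_add_iff_right hfin).1 ?_
  calc (excess I w : ℝ≥0∞) + μ.toOuterMeasure (G.nbhd I)
      ≤ ∑' v, μ v * ((excess I w : ℝ≥0∞) + I.indicator 1 v) := by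
        simp only [mul_add]
        rw [ENNReal.tsum_add, ENNReal.tsum_mul_right, μ.tsum_coe, one_mul, hsum]
        exact add_le_add_right hle _
    _ ≤ ∑' v, μ v * (∑' z, G.arrival Φ w v z * (excess I z : ℝ≥0∞) +
          (G.nbhd I).indicator 1 v) := by
        refine ENNReal.tsum_le_tsum fun v => mul_le_mul_right ?_ _
        have hone : ∑' z, G.arrival Φ w v z * (G.nbhd I).indicator 1 v =
            (G.nbhd I).indicator 1 v := by
          rw [ENNReal.tsum_mul_right, PMF.tsum_coe, one_mul]
        rw [← hone, ← ENNReal.tsum_add]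
        simp only [← mul_add]
        exact PMF.le_tsum_mul _ _ _ fun z hz => excess_add_le hI hz hpos
    _ = _ := by
        simp only [mul_add]
        rw [ENNReal.tsum_add, hsum, ← PMF.tsum_bind_mul]
        rfl

/-- Since the excess vanishes at the empty word, killing there preserves the submartingale
inequality. After `n` steps the excess is at most the length, itself at most the initial length plus
`n`. -/
theorem excess_le_mul_avoidProb {I : Set V} (hI : G.IsIndep I) (Φ : G.ClassPolicy) (μ : PMF V)
    (hle : μ.toOuterMeasure (G.nbhd I) ≤ μ.toOuterMeasure I) (n : ℕ) (w : G.QueueDetail) :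
    (excess I w : ℝ≥0∞) ≤
      ((w.1.length + n : ℕ) : ℝ≥0∞) * avoidProb (G.transition Φ μ) (QueueDetail.empty G) n w := by
  induction n generalizing w with
  | zero =>
    rw [avoidProb_zero, mul_one]
    exact_mod_cast excess_le_length I w
  | succ n ih =>
    refine (excess_le_tsum hI Φ μ hle w).trans ?_
    rw [← killedStep_eq _ (QueueDetail.empty G) _ (by simp [excess, QueueDetail.empty]),
      avoidProb_succ, ← killedStep_const_mul]
    refine killedStep_le_killedStep _ _ fun z hz _ => (ih z).trans (mul_le_mul_left ?_ _)
    have := length_le_of_transition_ne_zero hz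
    exact_mod_cast (by omega : z.1.length + n ≤ w.1.length + (n + 1))

theorem lt_of_positiveRecurrent (Φ : G.ClassPolicy) (μ : PMF V) (hμ : ∀ v, μ v ≠ 0)
    (hpr : PositiveRecurrent (G.transition Φ μ)) {I : Set V} (hI : G.IsIndep I) :
    μ.toOuterMeasure I < μ.toOuterMeasure (G.nbhd I) := by
  classical
  by_contra hlt
  have hle := not_lt.1 hlt
  obtain ⟨i, hi⟩ := hI.1
  have hna : ¬ (G.available (QueueDetail.empty G).classDetail i).Nonempty := by
    rintro ⟨j, hj⟩
    exact absurd (mem_available.1 hj).2 (by simp [QueueDetail.classDetail, QueueDetail.empty])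
  set w := G.enqueue (QueueDetail.empty G) i hna with hw
  have hw1 : w.1 = [i] := rfl
  have hexc : excess I w = 1 := by
    have hin : i ∉ G.nbhd I := fun ⟨u, hu, hui⟩ => hI.2 u hu i hi hui
    simp [excess, hw1, hi, hin]
  have hstep : G.transition Φ μ (QueueDetail.empty G) w ≠ 0 := by
    refine transition_ne_zero.2 ⟨i, hμ i, ?_⟩
    rw [arrival_of_not_nonempty Φ _ i hna, ← PMF.mem_support_iff, PMF.mem_support_pure_iff]
  have hlow : ∀ n : ℕ, ((n + 1 : ℕ) : ℝ≥0∞)⁻¹ ≤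
      avoidProb (G.transition Φ μ) (QueueDetail.empty G) n w := by
    intro n
    have h := excess_le_mul_avoidProb hI Φ μ hle n w
    rw [hexc, hw1, List.length_singleton, Nat.cast_one, add_comm 1 n] at h
    rw [← one_div]
    exact ENNReal.div_le_of_le_mul' h
  have hdiv : ∑' n : ℕ, ((n + 1 : ℕ) : ℝ≥0∞)⁻¹ = ∞ := by
    by_contra hne
    have h := ENNReal.summable_toReal hne
    simp only [ENNReal.toReal_inv, ENNReal.toReal_natCast] at h
    exact Real.not_summable_natCast_inv ((summable_nat_add_iff 1).1 h)
  have hpr0 := hpr (QueueDetail.empty G)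
  -- The term `n = 0` is dropped; the others are bounded below by going to `w` first and then
  -- avoiding the empty word for `n` steps.
  rw [lintegral_returnTime, tsum_eq_zero_add' ENNReal.summable] at hpr0
  refine absurd hpr0 (not_lt.2 (le_trans ?_ le_add_self))
  calc ∞ = G.transition Φ μ (QueueDetail.empty G) w * ∑' n : ℕ, ((n + 1 : ℕ) : ℝ≥0∞)⁻¹ := by
        rw [hdiv, ENNReal.mul_top hstep]
    _ ≤ _ := by
        rw [← ENNReal.tsum_mul_left]
        refine ENNReal.tsum_le_tsum fun n => ?_
        rw [avoidProb_succ]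
        refine le_trans (mul_le_mul_right (hlow n) _) (le_killedStep _ _ _ _ ?_)
        intro h
        have := congrArg (fun z => z.1.length) h
        simp [hw1, QueueDetail.empty] at this

end Necessity

end LoopGraph

/-! ### Sufficiency of `Ncond` under Max-Weight: quadratic drift. -/

namespace LoopGraph

variable {V : Type*} [Fintype V] [DecidableEq V] {G : LoopGraph V}

section Sufficiency

-- Otherwise `{v}` would be independent with an empty neighbourhood.
omit [Fintype V] [DecidableEq V] in
theorem exists_adj_of_mem_Ncond {μ : PMF V} (h : μ ∈ G.Ncond) (v : V) : ∃ u, G.Adj v u := by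
  by_contra hv
  push Not at hv
  have hlt := h.2 {v} ⟨Set.singleton_nonempty v, by rintro i rfl j rfl; exact hv _⟩
  have he : G.nbhd {v} = ∅ := by
    ext u
    simp [nbhd, hv]
  rw [he, measure_empty] at hlt
  exact absurd hlt not_lt_zero

open Classical in
/-- The largest value of `y` among the neighbours of `v`. -/
noncomputable def nbhdMax (G : LoopGraph V) (y : V → ℕ) (v : V) : ℕ :=
  (Finset.univ.filter (G.Adj v)).sup y

omit [DecidableEq V] in
theorem lt_nbhdMax {y : V → ℕ} {v : V} {t : ℕ} :
    t < G.nbhdMax y v ↔ ∃ u, G.Adj v u ∧ t < y u := by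
  simp [nbhdMax, Finset.lt_sup_iff]

open Classical in
/-- The number of stored items of each class, where classes with a self-loop are ignored. -/
noncomputable def looplessCount (w : G.QueueDetail) (v : V) : ℕ :=
  if G.Adj v v then 0 else w.1.count v

omit [DecidableEq V] in
theorem toReal_toOuterMeasure (μ : PMF V) (s : Set V) :
    (μ.toOuterMeasure s).toReal = ∑ v, s.indicator (fun v => (μ v).toReal) v := by
  rw [PMF.toOuterMeasure_apply_fintype, ENNReal.toReal_sum]
  · refine Finset.sum_congr rfl fun v _ => ?_
    by_cases hv : v ∈ s <;> simp [hv]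
  · intro v _
    exact ne_top_of_le_ne_top (μ.apply_ne_top v) (Set.indicator_le_self _ _ _)

omit [DecidableEq V] in
/-- The gaps in the inequalities that define `Ncond` are bounded below. -/
theorem exists_gap_of_mem_Ncond {μ : PMF V} (h : μ ∈ G.Ncond) : ∃ ε : ℝ, 0 < ε ∧
    ∀ I : Set V, G.IsIndep I → ∑ v, I.indicator (fun v => (μ v).toReal) v + ε ≤
      ∑ v, (G.nbhd I).indicator (fun v => (μ v).toReal) v := by
  classical
  -- There are finitely many sets, so the least gap is attained; the default `1` on sets that are
  -- not independent keeps the minimum positive.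
  obtain ⟨I₀, h₀⟩ := Finite.exists_min fun I : Set V => if G.IsIndep I then
    (μ.toOuterMeasure (G.nbhd I)).toReal - (μ.toOuterMeasure I).toReal else 1
  refine ⟨if G.IsIndep I₀ then
    (μ.toOuterMeasure (G.nbhd I₀)).toReal - (μ.toOuterMeasure I₀).toReal else 1, ?_, fun I hI => ?_⟩
  rotate_left
  · have := h₀ I
    rw [if_pos hI] at this
    rw [← toReal_toOuterMeasure, ← toReal_toOuterMeasure]
    linarith
  · have hfin : ∀ s : Set V, μ.toOuterMeasure s ≠ ∞ := fun s =>
      ne_top_of_le_ne_top ENNReal.one_ne_top (by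
        rw [PMF.toOuterMeasure_apply, ← μ.tsum_coe]
        exact ENNReal.tsum_le_tsum fun v => Set.indicator_le_self _ _ _)
    split_ifs with hI
    · exact sub_pos.2 ((ENNReal.toReal_lt_toReal (hfin _) (hfin _)).2 (h.2 I₀ hI))
    · exact one_pos

omit [DecidableEq V] in
/-- Summing the inequalities for the level sets of a function whose positivity set has no edge. -/
theorem sum_mul_add_le_sum_mul_nbhdMax {m : V → ℝ} {ε : ℝ} (hε0 : 0 ≤ ε)
    (hε : ∀ I : Set V, G.IsIndep I → ∑ v, I.indicator m v + ε ≤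
      ∑ v, (G.nbhd I).indicator m v) (hm : ∀ v, 0 ≤ m v) (y : V → ℕ)
    (hy : ∀ u v, G.Adj u v → y u = 0 ∨ y v = 0) (i : V) :
    ∑ v, m v * (y v : ℝ) + ε * (y i : ℝ) ≤ ∑ v, m v * (G.nbhdMax y v : ℝ) := by
  classical
  obtain ⟨N, hN⟩ : ∃ N, ∀ v, y v ≤ N :=
    ⟨Finset.univ.sup y, fun v => Finset.le_sup (Finset.mem_univ v)⟩
  -- Layer-cake decomposition, which turns both weighted sums into sums of measures of level sets.
  have hcast : ∀ k ≤ N, (k : ℝ) = ∑ t ∈ Finset.range N, if t < k then (1 : ℝ) else 0 := by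
    intro k hk
    rw [Finset.sum_boole]
    congr 1
    have : (Finset.range N).filter (· < k) = Finset.range k := by
      ext t
      simp only [Finset.mem_filter, Finset.mem_range]
      omega
    rw [this, Finset.card_range]
  have hM : ∀ v, G.nbhdMax y v ≤ N := fun v => Finset.sup_le fun u _ => hN u
  have hlevel : ∀ k : V → ℕ, (∀ v, k v ≤ N) → ∑ v, m v * (k v : ℝ) =
      ∑ t ∈ Finset.range N, ∑ v, {v | t < k v}.indicator m v := by
    intro k hk
    rw [Finset.sum_comm]
    refine Finset.sum_congr rfl fun v _ => ?_
    rw [hcast (k v) (hk v), Finset.mul_sum]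
    refine Finset.sum_congr rfl fun t _ => ?_
    rw [Set.indicator_apply]
    simp
  rw [hlevel y hN, hlevel _ hM, hcast (y i) (hN i), Finset.mul_sum, ← Finset.sum_add_distrib]
  refine Finset.sum_le_sum fun t _ => ?_
  have hnb : {v | t < G.nbhdMax y v} = G.nbhd {v | t < y v} := by
    ext v
    simp only [nbhd, Set.mem_ofPred_eq, lt_nbhdMax]
    exact ⟨fun ⟨u, h1, h2⟩ => ⟨u, h2, G.symm _ _ h1⟩, fun ⟨u, h1, h2⟩ => ⟨u, G.symm _ _ h2, h1⟩⟩
  rw [hnb]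
  -- The gap `ε` is gained at each level `t < y i`, where the level set contains `i` and so is not
  -- empty.
  by_cases hne : ({v | t < y v} : Set V).Nonempty
  · have hind : G.IsIndep {v | t < y v} := by
      refine ⟨hne, fun u hu v hv huv => ?_⟩
      simp only [Set.mem_ofPred_eq] at hu hv
      rcases hy u v huv with h | h <;> omega
    refine le_trans (add_le_add_right ?_ _) (hε _ hind)
    split_ifs <;> simp [hε0]
  · have hnot : ∀ v, ¬ t < y v := fun v hv => hne ⟨v, hv⟩
    have he : ({v | t < y v} : Set V) = ∅ := Set.not_nonempty_iff_eq_empty.1 hne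
    rw [he, if_neg (hnot i)]
    simp only [Set.indicator_empty, Finset.sum_const_zero, mul_zero, add_zero]
    exact Finset.sum_nonneg fun v _ => Set.indicator_nonneg (fun v _ => hm v) v

/-- The sum of the squares of the numbers of stored items. -/
noncomputable def sqSum (w : G.QueueDetail) : ℝ := ∑ i, (w.1.count i : ℝ) ^ 2

theorem sqSum_nonneg (w : G.QueueDetail) : 0 ≤ sqSum w :=
  Finset.sum_nonneg fun _ _ => sq_nonneg _

omit [Fintype V] in
theorem looplessCount_le (w : G.QueueDetail) (v : V) : looplessCount w v ≤ w.1.count v := by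
  unfold looplessCount
  split_ifs <;> omega

omit [Fintype V] in
theorem looplessCount_eq_zero_or {w : G.QueueDetail} {u v : V} (h : G.Adj u v) :
    looplessCount w u = 0 ∨ looplessCount w v = 0 := by
  by_cases huv : u = v
  · subst huv
    simp [looplessCount, h]
  · have h1 := looplessCount_le w u
    have h2 := looplessCount_le w v
    rcases Nat.mul_eq_zero.1 (w.2.1 u v huv h) with h0 | h0 <;> omega

/-- A stored item adds `2 x(v) + 1` to the sum of squares, while no neighbour of `v` is present. A
match with class `j` adds `-2 x(j) + 1`, and `x(j)` falls short of the maximum over the neighbours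
by at most `2R/β`. -/
theorem sqSum_le_of_arrival_ne_zero {β : ℝ} (hβ : 0 < β) (r : V → V → ℝ) {w w' : G.QueueDetail}
    {v : V} (h : G.arrival (G.maxWeight β r) w v w' ≠ 0) :
    sqSum w' ≤ sqSum w + 2 * (looplessCount w v - G.nbhdMax (looplessCount w) v) +
      (1 + 4 * (∑ i, ∑ j, |r i j|) / β) := by
  classical
  set R := ∑ i, ∑ j, |r i j| with hR
  have hrR : ∀ i j, |r i j| ≤ R := fun i j =>
    (Finset.single_le_sum (f := fun j => |r i j|) (fun _ _ => abs_nonneg _)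
      (Finset.mem_univ j)).trans
    (Finset.single_le_sum (f := fun i => ∑ j, |r i j|)
      (fun _ _ => Finset.sum_nonneg fun _ _ => abs_nonneg _) (Finset.mem_univ i))
  have hR0 : 0 ≤ R := (abs_nonneg _).trans (hrR v v)
  have hsq : ∀ (f g : V → ℝ) (a : V) (c : ℝ), (∀ i, f i = g i + if a = i then c else 0) →
      ∑ i, f i ^ 2 = ∑ i, g i ^ 2 + (2 * c * g a + c ^ 2) := by
    intro f g a c hfg
    have : ∀ i, f i ^ 2 = g i ^ 2 + if a = i then 2 * c * g a + c ^ 2 else 0 := by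
      intro i
      rw [hfg]
      split_ifs with hi
      · subst hi; ring
      · ring
    rw [Finset.sum_congr rfl fun i _ => this i, Finset.sum_add_distrib, Finset.sum_ite_eq]
    simp
  rcases arrival_ne_zero h with ⟨ha, rfl⟩ | ⟨ha, j, hj, rfl⟩
  · have hz : ∀ u, G.Adj v u → w.1.count u = 0 := by
      intro u hu
      by_contra hc
      exact ha ⟨u, mem_available.2 ⟨hu, Nat.pos_of_ne_zero hc⟩⟩
    have hM : G.nbhdMax (looplessCount w) v = 0 := by
      by_contra hc
      obtain ⟨u, hu, hpos⟩ := lt_nbhdMax.1 (Nat.pos_of_ne_zero hc)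
      have := looplessCount_le w u
      have := hz u hu
      omega
    -- If `v` has a self-loop it is its own neighbour, so being unmatched means that no `v`-item is
    -- stored.
    have hx : looplessCount w v = w.1.count v := by
      unfold looplessCount
      split_ifs with hv
      · exact (hz v hv).symm
      · rfl
    have := hsq (fun i => ((G.enqueue w v ha).1.count i : ℝ)) (fun i => (w.1.count i : ℝ)) v 1
      fun i => by
        simp only [enqueue, List.count_append, List.count_singleton, beq_iff_eq]
        push_cast
        rfl
    have hpos : 0 ≤ 4 * R / β := by positivity
    rw [sqSum, this, hM, hx, sqSum]
    push_cast
    linarith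
  · obtain ⟨-, hp⟩ := perm_cons_erase_of_choice hj
    have hmem := (PMF.mem_support_uniformOfFinset_iff
      (G.maxWeightSet_nonempty β r w.classDetail v ha) j).1 ((PMF.mem_support_iff _ _).2 hj)
    have hmax := (Finset.mem_filter.1 hmem).2
    -- Comparing `j` with a longest neighbour `u` in the Max-Weight rule: the two rewards differ by
    -- at most `2R`.
    have hM : (G.nbhdMax (looplessCount w) v : ℝ) ≤ w.1.count j + 2 * R / β := by
      by_cases h0 : G.nbhdMax (looplessCount w) v = 0
      · rw [h0, Nat.cast_zero]
        positivity
      · obtain ⟨u, hu, hlt⟩ := lt_nbhdMax.1 (Nat.sub_one_lt h0)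
        have hle : G.nbhdMax (looplessCount w) v ≤ w.1.count u := by
          have := looplessCount_le w u
          omega
        have hk := hmax u (mem_available.2 ⟨hu, by
          change 0 < w.1.count u
          omega⟩)
        simp only [QueueDetail.classDetail] at hk
        have h1 := abs_le.1 (hrR v u)
        have h2 := abs_le.1 (hrR v j)
        have h3 : (w.1.count u : ℝ) ≤ w.1.count j + 2 * R / β := by
          rw [← sub_le_iff_le_add', le_div_iff₀ hβ]
          linarith
        exact le_trans (by exact_mod_cast hle) h3
    have := hsq (fun i => ((G.dequeue w j).1.count i : ℝ)) (fun i => (w.1.count i : ℝ)) j (-1)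
      fun i => by
        have hc := hp.count_eq i
        rw [List.count_cons] at hc
        simp only [dequeue]
        rw [hc]
        push_cast
        simp only [beq_iff_eq]
        split_ifs <;> simp
    have hx : (0 : ℝ) ≤ looplessCount w v := Nat.cast_nonneg _
    rw [sqSum, this, sqSum]
    have h4 : 4 * R / β = 2 * (2 * R / β) := by ring
    linarith

theorem finite_length_le (n : ℕ) : {w : G.QueueDetail | w.1.length ≤ n}.Finite :=
  (List.finite_length_le V n).preimage Subtype.val_injective.injOn

theorem length_le_sum_looplessCount (w : G.QueueDetail) :
    w.1.length ≤ ∑ v, looplessCount w v + Fintype.card V := by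
  have h1 : ∑ v, w.1.count v = w.1.length := by
    rw [← List.sum_toFinset_count_eq_length]
    refine (Finset.sum_subset (Finset.subset_univ _) fun v _ hv => ?_).symm
    exact List.count_eq_zero.2 fun h => hv (List.mem_toFinset.2 h)
  rw [← h1, ← Finset.card_univ, Finset.card_eq_sum_ones, ← Finset.sum_add_distrib]
  refine Finset.sum_le_sum fun v _ => ?_
  unfold looplessCount
  split_ifs with hv
  · have := w.2.2 v hv
    omega
  · omega

/-- The nonnegativity is recorded because `ENNReal.ofReal` truncates: without it, a constant could
not be added inside. -/
theorem tsum_transition_mul_sqSum_le {β : ℝ} (hβ : 0 < β) (r : V → V → ℝ) (μ : PMF V)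
    (w : G.QueueDetail) :
    0 ≤ sqSum w + 2 * (∑ v, (μ v).toReal * looplessCount w v -
        ∑ v, (μ v).toReal * G.nbhdMax (looplessCount w) v) +
        (1 + 4 * (∑ i, ∑ j, |r i j|) / β) ∧
    ∑' z, G.transition (G.maxWeight β r) μ w z * ENNReal.ofReal (sqSum z) ≤
      ENNReal.ofReal (sqSum w + 2 * (∑ v, (μ v).toReal * looplessCount w v -
        ∑ v, (μ v).toReal * G.nbhdMax (looplessCount w) v) +
        (1 + 4 * (∑ i, ∑ j, |r i j|) / β)) := by
  set C := 1 + 4 * (∑ i, ∑ j, |r i j|) / β with hC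
  set a : V → ℝ := fun v => sqSum w +
    2 * (looplessCount w v - G.nbhdMax (looplessCount w) v) + C with ha
  have ha0 : ∀ v, 0 ≤ a v := fun v => by
    obtain ⟨z, hz⟩ := (G.arrival (G.maxWeight β r) w v).support_nonempty
    exact (sqSum_nonneg z).trans
      (sqSum_le_of_arrival_ne_zero hβ r ((PMF.mem_support_iff _ _).1 hz))
  have hsum : ∑ v, (μ v).toReal = 1 := by
    rw [← ENNReal.toReal_sum fun v _ => μ.apply_ne_top v, ← tsum_fintype (L := .unconditional V),
      μ.tsum_coe, ENNReal.toReal_one]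
  have hmean : ∑ v, (μ v).toReal * a v = sqSum w +
      2 * (∑ v, (μ v).toReal * looplessCount w v -
        ∑ v, (μ v).toReal * G.nbhdMax (looplessCount w) v) + C := by
    have : ∀ v, (μ v).toReal * a v = (μ v).toReal * (sqSum w + C) +
        2 * ((μ v).toReal * looplessCount w v -
          (μ v).toReal * G.nbhdMax (looplessCount w) v) := fun v => by
      rw [ha]; ring
    rw [Finset.sum_congr rfl fun v _ => this v, Finset.sum_add_distrib, ← Finset.sum_mul,
      hsum, ← Finset.mul_sum, Finset.sum_sub_distrib]
    ring
  rw [← hmean]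
  refine ⟨Finset.sum_nonneg fun v _ => mul_nonneg ENNReal.toReal_nonneg (ha0 v), ?_⟩
  calc _ = ∑' v, μ v * ∑' z, G.arrival (G.maxWeight β r) w v z * ENNReal.ofReal (sqSum z) :=
        PMF.tsum_bind_mul _ _ _
    _ ≤ ∑' v, μ v * ENNReal.ofReal (a v) :=
        ENNReal.tsum_le_tsum fun v => mul_le_mul_right (PMF.tsum_mul_le _ _ _ fun z hz =>
          ENNReal.ofReal_le_ofReal (sqSum_le_of_arrival_ne_zero hβ r hz)) _
    _ = ENNReal.ofReal (∑ v, (μ v).toReal * a v) := by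
        rw [tsum_fintype, ENNReal.ofReal_sum_of_nonneg fun v _ =>
          mul_nonneg ENNReal.toReal_nonneg (ha0 v)]
        refine Finset.sum_congr rfl fun v _ => ?_
        rw [ENNReal.ofReal_mul ENNReal.toReal_nonneg, ENNReal.ofReal_toReal (μ.apply_ne_top v)]

theorem positiveRecurrent_of_mem_Ncond {β : ℝ} (hβ : 0 < β) (r : V → V → ℝ) {μ : PMF V}
    (hμ : μ ∈ G.Ncond) : PositiveRecurrent (G.transition (G.maxWeight β r) μ) := by
  classical
  obtain ⟨ε, hε, hgap⟩ := exists_gap_of_mem_Ncond hμ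
  set C := 1 + 4 * (∑ i, ∑ j, |r i j|) / β with hC
  set D := Fintype.card V with hD
  -- A word longer than `n + D` has at least `n` items of classes without self-loop, the other
  -- classes holding at most one item each. Summing `hi` over the `D` classes gives `ε * n ≤ D * (B
  -- - A)`, so this `n` makes `2 * (B - A)` at least `C + 1`, a drift of at most `-1`.
  obtain ⟨n, hn⟩ := exists_nat_gt (D * (C + 1) / (2 * ε))
  refine positiveRecurrent_of_drift _
    (transGen_transition _ μ hμ.1 (exists_adj_of_mem_Ncond hμ))
    (fun w => ENNReal.ofReal (sqSum w)) (fun w => ENNReal.ofReal_ne_top)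
    {w | w.1.length ≤ n + D} (finite_length_le _) 1 (ENNReal.ofReal (C + 1)) one_ne_zero
    ENNReal.ofReal_ne_top fun w => ?_
  have hC0 : 0 ≤ C := by positivity
  set A := ∑ v, (μ v).toReal * (looplessCount w v : ℝ) with hA
  set B := ∑ v, (μ v).toReal * (G.nbhdMax (looplessCount w) v : ℝ) with hB
  have hi : ∀ i, ε * (looplessCount w i : ℝ) ≤ B - A := fun i => by
    have := sum_mul_add_le_sum_mul_nbhdMax hε.le hgap (fun v => ENNReal.toReal_nonneg)
      (looplessCount w) (fun u v h => looplessCount_eq_zero_or h) i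
    linarith
  have hD0 : 0 < D := Fintype.card_pos_iff.2 (let ⟨v, _⟩ := μ.support_nonempty; ⟨v⟩)
  have hAB : 0 ≤ B - A := by
    obtain ⟨v⟩ := Fintype.card_pos_iff.1 hD0
    exact le_trans (by positivity) (hi v)
  obtain ⟨h0, hstep⟩ := tsum_transition_mul_sqSum_le hβ r μ w
  have hfin : ∀ b : ℝ, 0 ≤ b → sqSum w + 2 * (A - B) + C + 1 ≤ sqSum w + b →
      ∑' z, G.transition (G.maxWeight β r) μ w z * ENNReal.ofReal (sqSum z) + 1 ≤
        ENNReal.ofReal (sqSum w) + ENNReal.ofReal b := by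
    intro b hb hle
    calc _ ≤ ENNReal.ofReal (sqSum w + 2 * (A - B) + C) + ENNReal.ofReal 1 := by
          rw [ENNReal.ofReal_one]
          exact add_le_add_left hstep 1
      _ = ENNReal.ofReal (sqSum w + 2 * (A - B) + C + 1) :=
          (ENNReal.ofReal_add h0 zero_le_one).symm
      _ ≤ ENNReal.ofReal (sqSum w + b) := ENNReal.ofReal_le_ofReal hle
      _ = _ := ENNReal.ofReal_add (sqSum_nonneg w) hb
  by_cases hw : w.1.length ≤ n + D
  · rw [Set.indicator_of_mem (by exact hw)]
    exact hfin _ (by linarith) (by linarith)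
  · rw [Set.indicator_of_notMem (by exact hw), ← ENNReal.ofReal_zero]
    refine hfin 0 le_rfl ?_
    have hlen : (n : ℝ) ≤ ∑ v, (looplessCount w v : ℝ) := by
      have := length_le_sum_looplessCount w
      exact_mod_cast (by omega : n ≤ ∑ v, looplessCount w v)
    have hsum : ε * ∑ v, (looplessCount w v : ℝ) ≤ D * (B - A) := by
      rw [Finset.mul_sum, hD, ← Finset.card_univ, ← nsmul_eq_mul]
      exact Finset.sum_le_card_nsmul _ _ _ fun v _ => hi v
    have h1 : D * (C + 1) < n * (2 * ε) := (div_lt_iff₀ (by positivity)).1 hn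
    have h2 : ε * n ≤ D * (B - A) := (mul_le_mul_of_nonneg_left hlen hε.le).trans hsum
    have h3 : (D : ℝ) * (C + 1) ≤ D * (2 * (B - A)) := by nlinarith
    have h4 := le_of_mul_le_mul_left h3 (by exact_mod_cast hD0)
    linarith

end Sufficiency

end LoopGraph

/-- Connectedness and non-bipartiteness are not used: the proof covers every `G`, and for a
bipartite graph both sides are empty. -/
theorem mainTheorem3 {V : Type*} [Fintype V] [DecidableEq V] (G : LoopGraph V)
    (hconn : G.Connected) (hbip : ¬ G.IsBipartiteGraph)
    (β : ℝ) (hβ : 0 < β) (r : V → V → ℝ) :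
    G.Stab (G.maxWeight β r) = G.Ncond := by
  ext μ
  exact ⟨fun h => ⟨h.1, fun I hI => LoopGraph.lt_of_positiveRecurrent _ μ h.1 h.2 hI⟩,
    fun h => ⟨h.1, LoopGraph.positiveRecurrent_of_mem_Ncond hβ r h⟩⟩
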